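/- Let $\mathcal{A}_0=\bigotimes_{k=1}^{\infty}M_2(\mathbb{C})=\bigcup_n\bigotimes_{k=1}^{n}M_2(\mathbb{C})$ be the algebraic infinite tensor product (with embeddings $x\mapsto x\otimes 1$), let $\tau$ be the product of the normalized traces on the factors $M_2(\mathbb{C})$, let $\mathcal{H}=L^2(\mathcal{A}_0,\tau)$ be the completion of $\mathcal{A}_0$ with respect to $\|x\|_2=\tau(x^*x)^{1/2}$, and let $\mathcal{A}_0$ act on $\mathcal{H}$ by left multiplication; the weak-operator closure $\mathcal{R}\subseteq B(\mathcal{H})$ of $\mathcal{A}_0$ is the hyperfinite $\mathrm{II}_1$-factor. Put $V=\begin{pmatrix}0&1\\0&0\end{pmatrix}$ and $V_n=I^{\otimes(n-1)}\otimes V\in\mathcal{A}_0$ for $n\ge 1$. Let $(c_n)_{n\ge1}$ be a sequence of complex numbers with $\sum_n|c_n|<\infty$ and $c_n\neq 0$ for infinitely many $n$ (for instance for all $n$), and let $A=\sum_{n=1}^{\infty}c_nV_n\in\mathcal{R}$, where the series converges in operator norm. An orthogonal projection $p\in B(\mathcal{H})$ is called hyperinvariant for $A$ if $pSp=Sp$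 for every $S\in B(\mathcal{H})$ with $SA=AS$. If $p$ is a hyperinvariant projection for $A$ with $p\neq 0$ and $p\neq 1$, then $$p\notin\bigcup_{n=1}^{\infty}\Big(\bigotimes_{k=1}^{n}M_2(\mathbb{C})\Big).$$ -/

import Mathlib

noncomputable section

namespace HyperfiniteTensor

/-! ## The finite stages `M₂(ℂ) ⊗ ⋯ ⊗ M₂(ℂ)` -/

/-- The algebra `⨂_{k=1}^n M₂(ℂ) = M_{2^n}(ℂ)`: matrices whose rows and columns are indexed by the
words of length `n` in the alphabet `{0, 1}`. -/
abbrev Stage (n : ℕ) : Type := Matrix (Fin n → Fin 2) (Fin n → Fin 2) ℂ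

/-- The elementary tensor `x₁ ⊗ ⋯ ⊗ xₙ` of `2 × 2` matrices. -/
def elementaryTensor {n : ℕ} (x : Fin n → Matrix (Fin 2) (Fin 2) ℂ) : Stage n :=
  Matrix.of fun i j => ∏ k, x k (i k) (j k)

theorem elementaryTensor_mul {n : ℕ} (x y : Fin n → Matrix (Fin 2) (Fin 2) ℂ) :
    elementaryTensor x * elementaryTensor y = elementaryTensor (fun k => x k * y k) := by
  ext i j
  simp only [elementaryTensor, Matrix.mul_apply, Matrix.of_apply]
  rw [Finset.prod_univ_sum, Fintype.piFinset_univ]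
  exact Finset.sum_congr rfl fun l _ => Finset.prod_mul_distrib.symm

theorem elementaryTensor_star {n : ℕ} (x : Fin n → Matrix (Fin 2) (Fin 2) ℂ) :
    star (elementaryTensor x) = elementaryTensor (fun k => star (x k)) := by
  ext i j
  simp [elementaryTensor, Matrix.star_apply]

/-- The first `m` letters of a word of length `n`. -/
def initial {m n : ℕ} (h : m ≤ n) (i : Fin n → Fin 2) : Fin m → Fin 2 :=
  fun k => i (Fin.castLE h k)

/-- The matrix `a ⊗ 1 ⊗ ⋯ ⊗ 1` of the stage `n`, for a matrix `a` of the stage `m ≤ n`. -/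
def ampliate {m n : ℕ} (h : m ≤ n) (a : Stage m) : Stage n :=
  Matrix.of fun i j =>
    if ∀ k : Fin n, m ≤ (k : ℕ) → i k = j k then a (initial h i) (initial h j) else 0

theorem sum_initial {m n : ℕ} (h : m ≤ n) (i : Fin n → Fin 2) (F : (Fin n → Fin 2) → ℂ) :
    (∑ j, if ∀ k : Fin n, m ≤ (k : ℕ) → i k = j k then F j else 0) =
      ∑ u : Fin m → Fin 2, F (fun k => if hk : (k : ℕ) < m then u ⟨k, hk⟩ else i k) := by
  rw [← Finset.sum_filter]
  refine Finset.sum_bij' (fun j _ => initial h j)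
    (fun u _ => fun k => if hk : (k : ℕ) < m then u ⟨k, hk⟩ else i k) ?_ ?_ ?_ ?_ ?_
  · simp
  · intro u _
    simp only [Finset.mem_filter, Finset.mem_univ, true_and]
    intro k hk
    simp [hk]
  · intro j hj
    simp only [Finset.mem_filter, Finset.mem_univ, true_and] at hj
    funext k
    by_cases hk : (k : ℕ) < m
    · simp only [hk, dif_pos, initial]; rfl
    · simp only [hk, dif_neg, not_false_eq_true]; exact hj k (not_lt.mp hk)
  · intro u _
    funext k
    simp [initial]
  · intro j hj
    simp only [Finset.mem_filter, Finset.mem_univ, true_and] at hj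
    congr 1
    funext k
    by_cases hk : (k : ℕ) < m
    · simp only [hk, dif_pos, initial]; rfl
    · simp only [hk, dif_neg, not_false_eq_true]; exact (hj k (not_lt.mp hk)).symm

theorem ampliate_mul {m n : ℕ} (h : m ≤ n) (a b : Stage m) :
    ampliate h (a * b) = ampliate h a * ampliate h b := by
  ext i j
  simp only [ampliate, Matrix.of_apply, Matrix.mul_apply, ite_mul, zero_mul]
  rw [sum_initial h i]
  have h1 : ∀ u : Fin m → Fin 2,
      initial h (fun k : Fin n => if hk : (k : ℕ) < m then u ⟨k, hk⟩ else i k) = u := by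
    intro u; funext k; simp [initial]
  simp only [h1]
  have h2 : ∀ u : Fin m → Fin 2, (∀ k : Fin n, m ≤ (k : ℕ) →
      (if hk : (k : ℕ) < m then u ⟨k, hk⟩ else i k) = j k) ↔
      ∀ k : Fin n, m ≤ (k : ℕ) → i k = j k := by
    intro u
    refine forall_congr' fun k => forall_congr' fun hk => ?_
    simp [not_lt.mpr hk]
  simp only [h2]
  split_ifs <;> simp

theorem ampliate_one {m n : ℕ} (h : m ≤ n) : ampliate h (1 : Stage m) = 1 := by
  ext i j
  simp only [ampliate, Matrix.of_apply, Matrix.one_apply]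
  by_cases hij : i = j
  · subst hij; simp
  · rw [if_neg hij]
    split_ifs with h1 h2
    · refine absurd ?_ hij
      funext k
      by_cases hk : (k : ℕ) < m
      · exact congrFun h2 ⟨k, hk⟩
      · exact h1 k (not_lt.mp hk)
    · rfl
    · rfl

/-- The embedding `a ↦ a ⊗ 1 ⊗ ⋯ ⊗ 1` of the stage `m` into the stage `n ≥ m`, as a unital
`*`-homomorphism. -/
def ampliateHom (m n : ℕ) (h : m ≤ n) : Stage m →⋆ₐ[ℂ] Stage n where
  toFun := ampliate h
  map_one' := ampliate_one h
  map_mul' := ampliate_mul h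
  map_zero' := by ext i j; simp [ampliate]
  map_add' a b := by ext i j; simp only [ampliate, Matrix.of_apply, Matrix.add_apply]; split_ifs <;> simp
  commutes' r := by
    rw [Algebra.algebraMap_eq_smul_one, Algebra.algebraMap_eq_smul_one, ← ampliate_one h]
    ext i j
    simp only [ampliate, Matrix.of_apply, Matrix.smul_apply]
    split_ifs <;> simp
  map_star' a := by
    ext i j
    simp only [ampliate, Matrix.star_apply, Matrix.of_apply, eq_comm (a := i _)]
    split_ifs <;> simp

instance : DirectedSystem Stage (ampliateHom · · ·) where
  map_self n a := by
    ext i j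
    have : ∀ k : Fin n, n ≤ (k : ℕ) → i k = j k := fun k hk => absurd k.2 (not_lt.mpr hk)
    change ampliate le_rfl a i j = a i j
    simp only [ampliate, Matrix.of_apply, if_pos this]
    rfl
  map_map k j i hij hjk a := by
    ext x y
    change ampliate hjk (ampliate hij a) x y = ampliate (hij.trans hjk) a x y
    have key : (∀ l : Fin k, i ≤ (l : ℕ) → x l = y l) ↔
        (∀ l : Fin k, j ≤ (l : ℕ) → x l = y l) ∧
        (∀ l : Fin j, i ≤ (l : ℕ) → initial hjk x l = initial hjk y l) := by
      constructor
      · intro H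
        exact ⟨fun l hl => H l (hij.trans hl), fun l hl => H (Fin.castLE hjk l) hl⟩
      · rintro ⟨H1, H2⟩ l hl
        by_cases hlj : (l : ℕ) < j
        · exact H2 ⟨l, hlj⟩ hl
        · exact H1 l (not_lt.mp hlj)
    simp only [ampliate, Matrix.of_apply, key]
    split_ifs with h1 h2 h3 h4
    · rfl
    · exact absurd ⟨h1, h2⟩ h3
    · exact absurd h4.2 h2
    · rfl
    · exact absurd (by assumption : _ ∧ _).1 h1
    · rfl

/-! ## The algebraic infinite tensor product and its product trace -/

/-- The algebraic infinite tensor product `⨂_{k=1}^∞ M₂(ℂ)`: the union (direct limit) of the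
`*`-algebras `⨂_{k=1}^n M₂(ℂ)` along the embeddings `a ↦ a ⊗ 1`. -/
def AlgTensor : Type := DirectLimit Stage ampliateHom

namespace AlgTensor

instance : Ring AlgTensor := inferInstanceAs (Ring (DirectLimit Stage ampliateHom))
instance : Algebra ℂ AlgTensor := inferInstanceAs (Algebra ℂ (DirectLimit Stage ampliateHom))
instance : StarRing AlgTensor := inferInstanceAs (StarRing (DirectLimit Stage ampliateHom))
instance : StarModule ℂ AlgTensor := inferInstanceAs (StarModule ℂ (DirectLimit Stage ampliateHom))

/-- The canonical embedding of the stage `n` into the algebraic infinite tensor product. -/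
def of (n : ℕ) : Stage n →⋆ₐ[ℂ] AlgTensor where
  toFun a := (⟦⟨n, a⟩⟧ : DirectLimit Stage ampliateHom)
  map_one' := (DirectLimit.one_def n).symm
  map_mul' a b := (DirectLimit.mul_def n a b).symm
  map_zero' := (DirectLimit.zero_def n).symm
  map_add' a b := (DirectLimit.add_def n a b).symm
  commutes' r := (DirectLimit.algebraMap_def n r).symm
  map_star' a := (DirectLimit.star_def n a).symm

theorem of_ampliateHom {m n : ℕ} (h : m ≤ n) (a : Stage m) :
    of n (ampliateHom m n h a) = of m a :=
  DirectLimit.mk_apply (f := ampliateHom) m n a h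

theorem exists_of (x : AlgTensor) : ∃ n a, x = of n a :=
  DirectLimit.exists_eq_mk ampliateHom x

theorem exists_of₂ (x y : AlgTensor) : ∃ n a b, x = of n a ∧ y = of n b :=
  DirectLimit.exists_eq_mk₂ ampliateHom x y

end AlgTensor

/-- The normalized trace `2⁻ⁿ Tr` of `⨂_{k=1}^n M₂(ℂ)`. -/
def stageTrace (n : ℕ) : Stage n →ₗ[ℂ] ℂ := ((2 : ℂ) ^ n)⁻¹ • Matrix.traceLinearMap _ ℂ ℂ

theorem stageTrace_apply {n : ℕ} (a : Stage n) : stageTrace n a = ((2 : ℂ) ^ n)⁻¹ * a.trace := rfl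

theorem stageTrace_ampliateHom (m n : ℕ) (h : m ≤ n) (a : Stage m) :
    stageTrace n (ampliateHom m n h a) = stageTrace m a := by
  obtain ⟨d, rfl⟩ := Nat.exists_eq_add_of_le h
  have h1 : (ampliateHom m (m + d) h a).trace = (2 : ℂ) ^ d * a.trace := by
    change ∑ i, ampliate h a i i = _
    simp only [ampliate, Matrix.of_apply, implies_true, if_true]
    rw [← (Fin.appendEquiv m d).sum_comp, Fintype.sum_prod_type]
    have h2 : ∀ (x : Fin m → Fin 2) (y : Fin d → Fin 2),
        initial h (Fin.appendEquiv m d (x, y)) = x := by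
      intro x y; funext k
      exact Fin.append_left x y k
    simp only [h2, Matrix.trace, Matrix.diag, Finset.sum_const, Finset.mul_sum]
    simp
  rw [stageTrace_apply, stageTrace_apply, h1, pow_add]
  field_simp

/-- The product trace `τ` on `⨂_{k=1}^∞ M₂(ℂ)`, with
`τ(x₁ ⊗ ⋯ ⊗ xₙ ⊗ 1 ⊗ ⋯) = ∏ₖ ½ Tr(xₖ)`. -/
def trace : AlgTensor →ₗ[ℂ] ℂ :=
  DirectLimit.Module.lift ℂ ℕ Stage ampliateHom stageTrace stageTrace_ampliateHom

theorem trace_of (n : ℕ) (a : Stage n) : trace (AlgTensor.of n a) = stageTrace n a := rfl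

theorem trace_elementaryTensor {n : ℕ} (x : Fin n → Matrix (Fin 2) (Fin 2) ℂ) :
    trace (AlgTensor.of n (elementaryTensor x)) = ∏ k, (2 : ℂ)⁻¹ * (x k).trace := by
  rw [trace_of, stageTrace_apply, Finset.prod_mul_distrib]
  simp only [Finset.prod_const, Finset.card_univ, Fintype.card_fin, inv_pow]
  congr 1
  simp only [Matrix.trace, Matrix.diag, elementaryTensor, Matrix.of_apply]
  rw [Finset.prod_univ_sum, Fintype.piFinset_univ]

/-! ## The standard Hilbert space `L²(⨂ M₂(ℂ), τ)` -/

theorem stageTrace_star {n : ℕ} (a : Stage n) : stageTrace n (star a) = star (stageTrace n a) := by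
  rw [stageTrace_apply, stageTrace_apply, Matrix.star_eq_conjTranspose, Matrix.trace_conjTranspose]
  simp

open scoped ComplexOrder in
theorem stageTrace_nonneg {n : ℕ} (a : Stage n) : 0 ≤ stageTrace n (star a * a) := by
  rw [stageTrace_apply]
  refine mul_nonneg (by positivity) ?_
  exact (Matrix.posSemidef_conjTranspose_mul_self a).trace_nonneg

open scoped ComplexOrder in
/-- The inner product `⟨x, y⟩ = τ(x* y)` on `⨂_{k=1}^∞ M₂(ℂ)`. -/
abbrev innerCore : InnerProductSpace.Core ℂ AlgTensor where
  inner x y := trace (star x * y)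
  conj_inner_symm x y := by
    obtain ⟨n, a, b, rfl, rfl⟩ := AlgTensor.exists_of₂ x y
    rw [← map_star, ← map_star, ← map_mul, ← map_mul, trace_of, trace_of]
    have := stageTrace_star (star b * a)
    rw [star_mul, star_star] at this
    rw [this]; simp
  re_inner_nonneg x := by
    obtain ⟨n, a, rfl⟩ := AlgTensor.exists_of x
    rw [← map_star, ← map_mul, trace_of]
    exact (RCLike.nonneg_iff.mp (stageTrace_nonneg a)).1
  add_left x y z := by rw [star_add, add_mul, map_add]
  smul_left x y r := by rw [star_smul, smul_mul_assoc, map_smul]; rfl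
  definite x hx := by
    obtain ⟨n, a, rfl⟩ := AlgTensor.exists_of x
    rw [← map_star, ← map_mul, trace_of, stageTrace_apply] at hx
    have h2 : ((2 : ℂ) ^ n)⁻¹ ≠ 0 := by positivity
    have h3 := (mul_eq_zero.mp hx).resolve_left h2
    rw [Matrix.trace_conjTranspose_mul_self_eq_zero_iff.mp h3, map_zero]

instance : NormedAddCommGroup AlgTensor := innerCore.toNormedAddCommGroup
instance : InnerProductSpace ℂ AlgTensor := InnerProductSpace.ofCore innerCore.toCore

theorem inner_def (x y : AlgTensor) : inner ℂ x y = trace (star x * y) := rfl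

/-- The Hilbert space `L²(⨂_{k=1}^∞ M₂(ℂ), τ) = L²(𝓡)`: the completion of `⨂_{k=1}^∞ M₂(ℂ)` for the
norm `‖x‖₂ = τ(x* x)^{1/2}`. -/
abbrev L2 : Type := UniformSpace.Completion AlgTensor

/-! ## The representation by left multiplication -/

theorem norm_mul_of_unitary {u : AlgTensor} (hu : star u * u = 1) (x : AlgTensor) :
    ‖u * x‖ = ‖x‖ := by
  have h : inner ℂ (u * x) (u * x) = inner ℂ x x := by
    rw [inner_def, inner_def, star_mul, mul_assoc, ← mul_assoc (star u), hu, one_mul]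
  rw [inner_self_eq_norm_sq_to_K, inner_self_eq_norm_sq_to_K] at h
  have h' : ‖u * x‖ ^ 2 = ‖x‖ ^ 2 := by exact_mod_cast h
  exact (pow_left_inj₀ (norm_nonneg _) (norm_nonneg _) two_ne_zero).mp h'

open scoped Matrix.Norms.L2Operator in
theorem exists_bound (x : AlgTensor) : ∃ C : ℝ, ∀ y : AlgTensor, ‖x * y‖ ≤ C * ‖y‖ := by
  obtain ⟨n, a, rfl⟩ := AlgTensor.exists_of x
  have ha : a ∈ Submodule.span ℂ (unitary (Stage n) : Set (Stage n)) := by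
    rw [CStarAlgebra.span_unitary]; trivial
  induction ha using Submodule.span_induction with
  | mem u hu =>
    refine ⟨1, fun y => ?_⟩
    rw [norm_mul_of_unitary, one_mul]
    rw [← map_star, ← map_mul, (Unitary.mem_iff.mp hu).1, map_one]
  | zero => exact ⟨0, fun y => by simp⟩
  | add a b _ _ ha hb =>
    obtain ⟨C, hC⟩ := ha
    obtain ⟨D, hD⟩ := hb
    refine ⟨C + D, fun y => ?_⟩
    rw [map_add, add_mul, add_mul]
    exact (norm_add_le _ _).trans (add_le_add (hC y) (hD y))
  | smul r a _ ha =>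
    obtain ⟨C, hC⟩ := ha
    refine ⟨‖r‖ * C, fun y => ?_⟩
    rw [map_smul, smul_mul_assoc, norm_smul, mul_assoc]
    exact mul_le_mul_of_nonneg_left (hC y) (norm_nonneg r)

/-- Left multiplication `y ↦ x y` on `⨂_{k=1}^∞ M₂(ℂ)`, as a `‖·‖₂`-bounded operator. -/
def leftMulPre (x : AlgTensor) : AlgTensor →L[ℂ] AlgTensor :=
  (LinearMap.mulLeft ℂ x).mkContinuousOfExistsBound (exists_bound x)

theorem leftMulPre_apply (x y : AlgTensor) : leftMulPre x y = x * y := rfl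

open UniformSpace.Completion in
/-- The representation `π` of `⨂_{k=1}^∞ M₂(ℂ)` on `L²` by left multiplication. The hyperfinite
factor `𝓡` is the closure of its range in the weak operator topology. -/
def leftMul : AlgTensor →⋆ₐ[ℂ] (L2 →L[ℂ] L2) where
  toFun x := (leftMulPre x).completion
  map_one' := by
    ext y
    induction y using induction_on with
    | hp => apply isClosed_eq <;> fun_prop
    | ih y => simp [leftMulPre_apply]
  map_mul' a b := by
    ext y
    induction y using induction_on with
    | hp => apply isClosed_eq <;> fun_prop
    | ih y => simp [leftMulPre_apply, mul_assoc]
  map_zero' := by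
    ext y
    induction y using induction_on with
    | hp => apply isClosed_eq <;> fun_prop
    | ih y => simp [leftMulPre_apply]
  map_add' a b := by
    ext y
    induction y using induction_on with
    | hp => apply isClosed_eq <;> fun_prop
    | ih y => simp [leftMulPre_apply, add_mul, coe_add]
  commutes' r := by
    ext y
    induction y using induction_on with
    | hp => apply isClosed_eq <;> fun_prop
    | ih y => simp [leftMulPre_apply, Algebra.algebraMap_eq_smul_one]
  map_star' a := by
    refine (ContinuousLinearMap.eq_adjoint_iff (leftMulPre (star a)).completion
      (leftMulPre a).completion).mpr ?_
    intro x y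
    induction x, y using induction_on₂ with
    | hp => apply isClosed_eq <;> fun_prop
    | ih x y => simp [leftMulPre_apply, inner_def, mul_assoc]

theorem leftMul_apply_coe (x y : AlgTensor) : leftMul x (y : L2) = ((x * y : AlgTensor) : L2) := by
  change (leftMulPre x).completion (y : L2) = _
  rw [ContinuousLinearMap.completion_apply_coe, leftMulPre_apply]

/-- The copy of `⨂_{k=1}^n M₂(ℂ)` inside `𝓡 ⊆ B(L²)`. -/
def finiteStage (n : ℕ) : Set (L2 →L[ℂ] L2) := Set.range fun a : Stage n => leftMul (AlgTensor.of n a)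

/-! ## The operator `A = ∑ₙ cₙ Vₙ` -/

/-- The matrix `V = (0 1; 0 0)`. -/
def matV : Matrix (Fin 2) (Fin 2) ℂ := !![0, 1; 0, 0]

/-- The element `I ⊗ ⋯ ⊗ I ⊗ V` of `⨂_{k=1}^∞ M₂(ℂ)`, with `n` factors `I` in front of `V` (sites are
numbered from `0`). -/
def siteV (n : ℕ) : AlgTensor :=
  AlgTensor.of (n + 1) (elementaryTensor fun k => if k = Fin.last n then matV else 1)

theorem siteV_anticomm (n : ℕ) : star (siteV n) * siteV n + siteV n * star (siteV n) = 1 := by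
  rw [siteV, ← map_star, ← map_mul, ← map_mul, ← map_add, elementaryTensor_star,
    elementaryTensor_mul, elementaryTensor_mul]
  rw [← map_one (AlgTensor.of (n + 1))]
  congr 1
  ext i j
  simp only [elementaryTensor, Matrix.add_apply, Matrix.of_apply, Fin.prod_univ_castSucc,
    if_true, (Fin.castSucc_lt_last _).ne, if_false, star_one, one_mul]
  rw [← mul_add, ← Matrix.add_apply]
  have h : star matV * matV + matV * star matV = 1 := by
    have hs : star matV = !![0, 0; 1, 0] := by
      ext a b
      fin_cases a <;> fin_cases b <;> simp [matV, Matrix.star_apply]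
    rw [hs, matV]
    ext a b
    fin_cases a <;> fin_cases b <;> simp
  rw [h, ← Fin.prod_univ_castSucc (f := fun k => (1 : Matrix (Fin 2) (Fin 2) ℂ) (i k) (j k))]
  by_cases hij : i = j
  · subst hij; simp
  · obtain ⟨k, hk⟩ := Function.ne_iff.mp hij
    rw [Matrix.one_apply_ne hij]
    exact Finset.prod_eq_zero (Finset.mem_univ k) (Matrix.one_apply_ne hk)

theorem norm_leftMul_siteV_le (n : ℕ) : ‖leftMul (siteV n)‖ ≤ 1 := by
  refine ContinuousLinearMap.opNorm_le_bound _ zero_le_one fun y => ?_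
  induction y using UniformSpace.Completion.induction_on with
  | hp => exact isClosed_le (by fun_prop) (by fun_prop)
  | ih y =>
    rw [leftMul_apply_coe, UniformSpace.Completion.norm_coe, UniformSpace.Completion.norm_coe,
      one_mul]
    have h : inner ℂ (siteV n * y) (siteV n * y) +
        inner ℂ (star (siteV n) * y) (star (siteV n) * y) = inner ℂ y y := by
      have h0 : star (siteV n * y) * (siteV n * y) +
          star (star (siteV n) * y) * (star (siteV n) * y) = star y * y := by
        rw [star_mul, star_mul, star_star, mul_assoc, mul_assoc, ← mul_add, ← mul_assoc (star _),
          ← mul_assoc (siteV n), ← add_mul, siteV_anticomm, one_mul]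
      rw [inner_def, inner_def, inner_def, ← map_add, h0]
    simp only [inner_self_eq_norm_sq_to_K] at h
    have h' : ‖siteV n * y‖ ^ 2 + ‖star (siteV n) * y‖ ^ 2 = ‖y‖ ^ 2 := by exact_mod_cast h
    refine (pow_le_pow_iff_left₀ (norm_nonneg _) (norm_nonneg _) two_ne_zero).mp ?_
    rw [← h']
    exact le_add_of_nonneg_right (sq_nonneg _)

/-- For `c ∈ ℓ¹` the series `∑ₙ cₙ Vₙ` converges in the operator norm. -/
theorem summable_smul_siteV {c : ℕ → ℂ} (hc : Summable fun n => ‖c n‖) :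
    Summable fun n => c n • leftMul (siteV n) := by
  refine Summable.of_norm_bounded hc fun n => ?_
  rw [norm_smul]
  exact mul_le_of_le_one_right (norm_nonneg _) (norm_leftMul_siteV_le n)

/-- The operator `A = ∑ₙ cₙ Vₙ` in `𝓡 ⊆ B(L²)`, the series being taken in the operator norm; it
converges for `c ∈ ℓ¹`. -/
def opA (c : ℕ → ℂ) : L2 →L[ℂ] L2 := ∑' n, c n • leftMul (siteV n)

end HyperfiniteTensor

/-! ## Hyperinvariant projections -/

/-- A projection `p` is hyperinvariant for `T` if its range is invariant under every bounded operator
that commutes with `T`. -/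
def IsHyperinvariantProjection {H : Type*} [NormedAddCommGroup H] [InnerProductSpace ℂ H]
    [CompleteSpace H] (T p : H →L[ℂ] H) : Prop :=
  IsStarProjection p ∧ ∀ S : H →L[ℂ] H, S * T = T * S → p * S * p = S * p

end

/-!
A projection `p` in the stage `n` has the form `q ⊗ 1 ⊗ 1 ⊗ ⋯`. It is shown that hyperinvariance
forces `q` to commute with the matrices `Vᵢ` and `Vᵢ*` at every site `i < n`. These generate the
full matrix algebra, so `q` is a scalar (`mem_range_scalar_of_commute_site`), and `p` is `0` or `1`.

The element `Vᵢ` commutes with `A`, so the range of `p` is invariant under `Vᵢ`. As `p` is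
self-adjoint, it remains to see that its range is invariant under `Vᵢ*`, which does not commute with
`A` if `cᵢ ≠ 0`. Choose a site `j > n` with `cⱼ ≠ 0`; this is where infinitely many nonzero
coefficients are needed. The operator `cᵢ Vᵢ + cⱼ Vⱼ` commutes with the flip of the sites `i` and `j`,
twisted by a diagonal similarity which makes up for the difference between `cᵢ` and `cⱼ`. Up to a
scalar factor, this twisted flip is

  `S = cⱼ² Vᵢ* Vⱼ + cᵢ² Vᵢ Vⱼ* + cᵢ cⱼ (Vᵢ Vᵢ* Vⱼ Vⱼ* + Vᵢ* Vᵢ Vⱼ* Vⱼ)`,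

an element of the algebraic tensor product that commutes with `A` (`commute_twistedFlip`), also if
`cᵢ = 0`. Hence `p S p = S p`. Since `p` commutes with everything at the site `j`, this relation holds
for each coefficient of `S` with respect to the matrix units at the site `j`
(`mul_mul_eq_of_twistedFlip`). The coefficient of `Vⱼ` is `cⱼ² Vᵢ*`, so `p Vᵢ* p = Vᵢ* p`.
-/

namespace HyperfiniteTensor

/-! ### Injectivity of the embeddings -/

open scoped ComplexOrder in
theorem AlgTensor.of_injective (n : ℕ) : Function.Injective (AlgTensor.of n) := by
  refine (injective_iff_map_eq_zero _).mpr fun a ha => ?_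
  have h : HyperfiniteTensor.trace (AlgTensor.of n (star a * a)) = 0 := by
    rw [map_mul, ha, mul_zero, map_zero]
  rw [trace_of, stageTrace_apply] at h
  exact Matrix.trace_conjTranspose_mul_self_eq_zero_iff.mp
    ((mul_eq_zero.mp h).resolve_left (by positivity))

/-- Evaluation at the vector `1` recovers `x` from `leftMul x`. -/
theorem leftMul_injective : Function.Injective leftMul := by
  intro x y h
  have h1 := congrArg (fun T : L2 →L[ℂ] L2 => T ((1 : AlgTensor) : L2)) h
  simp only [leftMul_apply_coe, mul_one] at h1
  exact UniformSpace.Completion.coe_injective _ h1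

/-! ### Elementary tensors -/

theorem elementaryTensor_eq_zero {n : ℕ} {x : Fin n → Matrix (Fin 2) (Fin 2) ℂ} (k : Fin n)
    (hk : x k = 0) : elementaryTensor x = 0 := by
  ext i j
  exact Finset.prod_eq_zero (Finset.mem_univ k) (by simp [hk])

theorem elementaryTensor_one {n : ℕ} :
    elementaryTensor (fun _ : Fin n => (1 : Matrix (Fin 2) (Fin 2) ℂ)) = 1 := by
  ext i j
  simp [elementaryTensor, Matrix.one_apply, Finset.prod_ite_zero, funext_iff]

theorem elementaryTensor_single {n : ℕ} (i j : Fin n → Fin 2) :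
    elementaryTensor (fun k => Matrix.single (i k) (j k) (1 : ℂ)) = Matrix.single i j 1 := by
  ext a b
  simp [elementaryTensor, Matrix.single_apply, Finset.prod_ite_zero, funext_iff, forall_and]

theorem ampliate_elementaryTensor {m n : ℕ} (h : m ≤ n)
    (x : Fin m → Matrix (Fin 2) (Fin 2) ℂ) :
    ampliate h (elementaryTensor x) =
      elementaryTensor fun k : Fin n => if hk : (k : ℕ) < m then x ⟨k, hk⟩ else 1 := by
  obtain ⟨d, rfl⟩ := Nat.exists_eq_add_of_le h
  ext i j
  have key : (∀ k : Fin (m + d), m ≤ (k : ℕ) → i k = j k) ↔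
      ∀ l : Fin d, i (Fin.natAdd m l) = j (Fin.natAdd m l) := by
    refine ⟨fun H l => H _ (by simp), fun H k hk => ?_⟩
    have := H ⟨k - m, by omega⟩
    convert this using 2 <;> ext <;> simp <;> omega
  simp only [ampliate, elementaryTensor, Matrix.of_apply, Fin.prod_univ_add, key]
  simp only [Fin.val_castAdd, Fin.is_lt, dif_pos, Fin.val_natAdd, Nat.not_lt.mpr (Nat.le_add_right _ _),
    dif_neg, not_false_eq_true, Matrix.one_apply, Finset.prod_ite_zero, Finset.mem_univ, true_imp_iff,
    Finset.prod_const_one, mul_ite, mul_one, mul_zero]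
  rfl

/-! ### Matrices at a single site -/

/-- The matrix `1 ⊗ ⋯ ⊗ 1 ⊗ a ⊗ 1 ⊗ ⋯ ⊗ 1` of the stage `n`, with `a` at the site `i`. It is the
identity if `n ≤ i`. As in `siteV`, sites are numbered from `0`. -/
noncomputable def stageSite (n i : ℕ) (a : Matrix (Fin 2) (Fin 2) ℂ) : Stage n :=
  elementaryTensor fun k => if (k : ℕ) = i then a else 1

/-- The element `1 ⊗ ⋯ ⊗ 1 ⊗ a` of the algebraic tensor product, with `a` at the site `i`. -/
noncomputable def site (i : ℕ) (a : Matrix (Fin 2) (Fin 2) ℂ) : AlgTensor :=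
  AlgTensor.of (i + 1) (stageSite (i + 1) i a)

theorem siteV_eq_site (i : ℕ) : siteV i = site i matV := by
  simp [siteV, site, stageSite, Fin.ext_iff]

theorem stageSite_mul (n i : ℕ) (a b : Matrix (Fin 2) (Fin 2) ℂ) :
    stageSite n i (a * b) = stageSite n i a * stageSite n i b := by
  rw [stageSite, stageSite, stageSite, elementaryTensor_mul]
  congr 1
  funext k
  split_ifs <;> simp

theorem of_stageSite {n i : ℕ} (h : i < n) (a : Matrix (Fin 2) (Fin 2) ℂ) :
    AlgTensor.of n (stageSite n i a) = site i a := by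
  rw [site, ← AlgTensor.of_ampliateHom (Nat.succ_le_of_lt h)]
  congr 1
  change _ = ampliate _ _
  rw [stageSite, stageSite, ampliate_elementaryTensor]
  congr 1
  funext k
  by_cases hk : (k : ℕ) = i
  · simp [hk]
  · simp [hk]

theorem site_star (i : ℕ) (a : Matrix (Fin 2) (Fin 2) ℂ) : site i (star a) = star (site i a) := by
  rw [site, site, ← map_star, stageSite, stageSite, elementaryTensor_star]
  congr 2
  funext k
  split_ifs <;> simp

theorem siteV_mul_self (i : ℕ) : siteV i * siteV i = 0 := by
  have h : matV * matV = 0 := by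
    ext a b
    fin_cases a <;> fin_cases b <;> simp [matV]
  rw [siteV_eq_site, site, ← map_mul, ← stageSite_mul, h, stageSite,
    elementaryTensor_eq_zero (Fin.last i) (by simp), map_zero]

theorem commute_site {i j : ℕ} (hij : i ≠ j) (a b : Matrix (Fin 2) (Fin 2) ℂ) :
    Commute (site i a) (site j b) := by
  rw [← of_stageSite (n := i + j + 1) (by omega), ← of_stageSite (n := i + j + 1) (i := j) (by omega)]
  refine Commute.map ?_ (AlgTensor.of _)
  rw [commute_iff_eq, stageSite, stageSite, elementaryTensor_mul, elementaryTensor_mul]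
  congr 1
  funext k
  split_ifs <;> first | omega | simp

/-- An element of the stage `n` has the form `b ⊗ 1 ⊗ 1 ⊗ ⋯`, so it commutes with everything that
lives on a site beyond the first `n`. -/
theorem commute_of_site {n j : ℕ} (h : n ≤ j) (b : Stage n) (a : Matrix (Fin 2) (Fin 2) ℂ) :
    Commute (AlgTensor.of n b) (site j a) := by
  rw [site, ← AlgTensor.of_ampliateHom (h.trans j.le_succ)]
  refine Commute.map ?_ (AlgTensor.of _)
  induction b using Matrix.induction_on' with
  | h_zero => rw [map_zero]; exact Commute.zero_left _
  | h_add p q hp hq => rw [map_add]; exact hp.add_left hq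
  | h_std_basis x y r =>
    rw [← mul_one r, ← smul_eq_mul, ← Matrix.smul_single, map_smul, ← elementaryTensor_single]
    refine Commute.smul_left ?_ r
    change Commute (ampliate _ _) _
    rw [commute_iff_eq, ampliate_elementaryTensor, stageSite, elementaryTensor_mul,
      elementaryTensor_mul]
    congr 1
    funext k
    split_ifs <;> first | omega | simp

/-! ### The commutant of the site matrices of a stage -/

/-- The matrices `V` and `V*` at the sites below `n` generate the full matrix algebra of the stage
`n`, so only scalar matrices commute with all of them. -/
theorem mem_range_scalar_of_commute_site {n : ℕ} {q : Stage n}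
    (hV : ∀ i < n, Commute (stageSite n i matV) q)
    (hU : ∀ i < n, Commute (stageSite n i (star matV)) q) :
    q ∈ Set.range (Matrix.scalar (Fin n → Fin 2)) := by
  have hs : star matV = !![0, 0; 1, 0] := by
    ext a b
    fin_cases a <;> fin_cases b <;> simp [matV, Matrix.star_apply]
  have hunit : ∀ i < n, ∀ a b : Fin 2,
      Commute (stageSite n i (Matrix.single a b (1 : ℂ))) q := by
    intro i hi a b
    have h00 : Matrix.single (0 : Fin 2) (0 : Fin 2) (1 : ℂ) = matV * star matV := by
      rw [hs]; ext a b; fin_cases a <;> fin_cases b <;> simp [matV]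
    have h01 : Matrix.single (0 : Fin 2) (1 : Fin 2) (1 : ℂ) = matV := by
      ext a b; fin_cases a <;> fin_cases b <;> simp [matV]
    have h10 : Matrix.single (1 : Fin 2) (0 : Fin 2) (1 : ℂ) = star matV := by
      rw [hs]; ext a b; fin_cases a <;> fin_cases b <;> simp
    have h11 : Matrix.single (1 : Fin 2) (1 : Fin 2) (1 : ℂ) = star matV * matV := by
      rw [hs]; ext a b; fin_cases a <;> fin_cases b <;> simp [matV]
    fin_cases a <;> fin_cases b <;>
      simp only [Fin.zero_eta, Fin.mk_one, h00, h01, h10, h11, stageSite_mul]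
    · exact (hV i hi).mul_left (hU i hi)
    · exact hV i hi
    · exact hU i hi
    · exact (hU i hi).mul_left (hV i hi)
  refine Matrix.mem_range_scalar_iff_commute_single'.mpr fun x y => ?_
  -- The matrix unit `e_{x,y}` is built up one tensor factor at a time.
  have step : ∀ m ≤ n, Commute (elementaryTensor fun k : Fin n =>
      if (k : ℕ) < m then Matrix.single (x k) (y k) (1 : ℂ) else 1) q := by
    intro m
    induction m with
    | zero => intro _; simp [elementaryTensor_one]
    | succ m ih =>
      intro hm
      have h := (ih (by omega)).mul_left (hunit m hm (x ⟨m, hm⟩) (y ⟨m, hm⟩))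
      rw [stageSite, elementaryTensor_mul] at h
      convert h using 2
      congr 1
      funext k
      rcases lt_trichotomy (k : ℕ) m with hk | hk | hk
      · simp [hk, hk.ne, hk.trans m.lt_succ_self]
      · obtain rfl : k = ⟨m, hm⟩ := Fin.ext hk
        simp
      · simp [hk.not_gt, hk.ne', show ¬ (k : ℕ) < m + 1 by omega]
  have h := step n le_rfl
  simpa [elementaryTensor_single] using h

/-! ### Operators commuting with `A` -/

/-- An element of the algebraic tensor product commutes with `A` as soon as it commutes with a finite
partial sum and with every `Vₙ` outside of it. -/
theorem commute_leftMul_opA {c : ℕ → ℂ} (hc : Summable fun n => ‖c n‖) {x : AlgTensor}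
    (s : Finset ℕ) (hs : Commute x (∑ n ∈ s, c n • siteV n))
    (h : ∀ n ∉ s, Commute x (siteV n)) : Commute (leftMul x) (opA c) := by
  rw [opA, ← (summable_smul_siteV hc).sum_add_tsum_compl (s := s)]
  refine Commute.add_right ?_ (Commute.tsum_right _ fun n => ?_)
  · simpa only [map_sum, map_smul] using hs.map leftMul
  · exact ((h n n.2).map leftMul).smul_right _

/-! ### The twisted flip of two sites -/

/-- Let `v, u` and `w, z` be commuting pairs of `2 × 2` matrix units `e₁₂, e₂₁`. After rescaling the
two pairs so that `a v + b w` becomes symmetric in them, the flip of the two tensor factors commutes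
with it; multiplying by `a b` gives the element below, which also makes sense for `a = 0`. -/
theorem commute_twistedFlip {R : Type*} [Ring R] [Algebra ℂ R] {v u w z : R} (a b : ℂ)
    (hv : v * v = 0) (hw : w * w = 0) (hvu : u * v + v * u = 1) (hwz : z * w + w * z = 1)
    (hvw : Commute v w) (hvz : Commute v z) (huw : Commute u w) :
    Commute (b ^ 2 • (u * w) + a ^ 2 • (v * z) + (a * b) • (v * u * (w * z) + u * v * (z * w)))
      (a • v + b • w) := by
  -- Normal form: `v`, `u` to the left of `w`, `z`, and `v` before `u`, `w` before `z`.
  have e1 : u * v = 1 - v * u := eq_sub_of_add_eq hvu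
  have e2 : z * w = 1 - w * z := eq_sub_of_add_eq hwz
  have e3 : ∀ t, u * (v * t) = t - v * (u * t) := fun t => by
    rw [← mul_assoc, e1, sub_mul, one_mul, mul_assoc]
  have e5 : ∀ t, v * (v * t) = 0 := fun t => by rw [← mul_assoc, hv, zero_mul]
  have e6 : ∀ t, w * (w * t) = 0 := fun t => by rw [← mul_assoc, hw, zero_mul]
  have c1 := hvw.eq.symm
  have c2 := hvz.eq.symm
  have c3 := huw.eq.symm
  have d1 : ∀ t, w * (v * t) = v * (w * t) := hvw.symm.left_comm
  have d3 : ∀ t, w * (u * t) = u * (w * t) := huw.symm.left_comm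
  rw [commute_iff_eq]
  simp only [mul_add, add_mul, smul_mul_assoc, mul_smul_comm, mul_assoc, c1, c2, c3, d1, d3, e1, e2,
    e3, e5, e6, hw, mul_sub, sub_mul, mul_one, one_mul, mul_zero, sub_zero, smul_zero]
  module

/-- The coefficient of the matrix unit `w = e₁₂` of the second tensor factor in the element of
`commute_twistedFlip` is cut out by `e₁₁ · e₂₂`. -/
theorem twistedFlip_compress {R : Type*} [Ring R] [Algebra ℂ R] {v u w z : R} (a b : ℂ)
    (hw : w * w = 0) (hz : z * z = 0) (hwz : z * w + w * z = 1)
    (hvw : Commute v w) (hvz : Commute v z) (huw : Commute u w) (huz : Commute u z) :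
    w * z * (b ^ 2 • (u * w) + a ^ 2 • (v * z) + (a * b) • (v * u * (w * z) + u * v * (z * w)))
      * (z * w) = b ^ 2 • (u * w) := by
  -- The normal form is the one used in `commute_twistedFlip`.
  have e2 : z * w = 1 - w * z := eq_sub_of_add_eq hwz
  have e4 : ∀ t, z * (w * t) = t - w * (z * t) := fun t => by
    rw [← mul_assoc, e2, sub_mul, one_mul, mul_assoc]
  have e6 : ∀ t, w * (w * t) = 0 := fun t => by rw [← mul_assoc, hw, zero_mul]
  have c2 := hvz.eq.symm
  have c3 := huw.eq.symm
  have d1 : ∀ t, w * (v * t) = v * (w * t) := hvw.symm.left_comm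
  have d2 : ∀ t, z * (v * t) = v * (z * t) := hvz.symm.left_comm
  have d3 : ∀ t, w * (u * t) = u * (w * t) := huw.symm.left_comm
  have d4 : ∀ t, z * (u * t) = u * (z * t) := huz.symm.left_comm
  simp only [mul_add, add_mul, smul_mul_assoc, mul_smul_comm, mul_assoc, c2, c3, d1, d2, d3, d4,
    e2, e4, e6, hz, mul_sub, mul_one, mul_zero, sub_zero, sub_self, smul_zero, add_zero, zero_add,
    add_sub_cancel_right]

/-- If the twisted flip `S` satisfies `P S P = S P` and `P` commutes with the second tensor factor,
then each coefficient `x` of `S` with respect to the second factor satisfies `P x P = x P`; the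
coefficient of `w = e₁₂` is a nonzero multiple of `u`. -/
theorem mul_mul_eq_of_twistedFlip {R : Type*} [Ring R] [Algebra ℂ R] {P v u w z : R} (a : ℂ)
    {b : ℂ} (hb : b ≠ 0)
    (hw : w * w = 0) (hz : z * z = 0) (hwz : z * w + w * z = 1)
    (hvw : Commute v w) (hvz : Commute v z) (huw : Commute u w) (huz : Commute u z)
    (hPw : Commute P w) (hPz : Commute P z)
    (h : P * (b ^ 2 • (u * w) + a ^ 2 • (v * z) +
        (a * b) • (v * u * (w * z) + u * v * (z * w))) * P =
      (b ^ 2 • (u * w) + a ^ 2 • (v * z) + (a * b) • (v * u * (w * z) + u * v * (z * w))) * P) :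
    P * u * P = u * P := by
  have hS := twistedFlip_compress a b hw hz hwz hvw hvz huw huz
  set S := b ^ 2 • (u * w) + a ^ 2 • (v * z) + (a * b) • (v * u * (w * z) + u * v * (z * w))
  have hP1 : Commute P (w * z) := hPw.mul_right hPz
  have hP2 : Commute P (z * w) := hPz.mul_right hPw
  have h1 : P * (w * z * S * (z * w)) * P = w * z * S * (z * w) * P := by
    calc P * (w * z * S * (z * w)) * P = P * (w * z) * S * (z * w * P) := by noncomm_ring
      _ = w * z * (P * S * P) * (z * w) := by rw [hP1.eq, ← hP2.eq]; noncomm_ring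
      _ = w * z * S * (P * (z * w)) := by rw [h]; noncomm_ring
      _ = w * z * S * (z * w) * P := by rw [hP2.eq]; noncomm_ring
  rw [hS, mul_smul_comm, smul_mul_assoc, smul_mul_assoc] at h1
  have h2 := smul_right_injective R (pow_ne_zero 2 hb) h1
  have h3 : (P * u * P - u * P) * w = 0 := by
    rw [sub_mul, mul_assoc, mul_assoc u, hPw.eq, ← mul_assoc, ← mul_assoc, mul_assoc P, h2,
      mul_assoc, sub_self]
  have h4 : Commute (P * u * P - u * P) z :=
    ((hPz.mul_left huz).mul_left hPz).sub_left (huz.mul_left hPz)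
  -- The element `X = P u P - u P` satisfies `X w = 0` and commutes with `z`.
  rw [← sub_eq_zero, ← mul_one (P * u * P - u * P), ← hwz, mul_add, ← mul_assoc, ← mul_assoc, h3,
    h4.eq, mul_assoc, h3, mul_zero, zero_mul, add_zero]

/-! ### Hyperinvariant projections in a finite stage -/

/-- A self-adjoint `P` with `P u P = u P` and `P u* P = u* P` commutes with `u`. -/
theorem commute_of_mul_mul_eq {R : Type*} [Ring R] [StarRing R] {P u : R} (hP : star P = P)
    (h : P * u * P = u * P) (h' : P * star u * P = star u * P) : Commute u P := by
  have h1 := congrArg star h'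
  simp only [star_mul, star_star, hP, ← mul_assoc] at h1
  exact h.symm.trans h1

theorem siteV_star_commute {i j : ℕ} (hij : i ≠ j) : Commute (siteV i) (star (siteV j)) := by
  rw [siteV_eq_site, siteV_eq_site, ← site_star]
  exact commute_site hij _ _

theorem siteV_commute (i j : ℕ) : Commute (siteV i) (siteV j) := by
  obtain rfl | hij := eq_or_ne i j
  · exact Commute.refl _
  · rw [siteV_eq_site, siteV_eq_site]
    exact commute_site hij _ _

/-- If an element `P` of the stage `n` is hyperinvariant for `A`, then its range is
invariant under `Vᵢ*` for each `i < n`, although `Vᵢ*` itself need not commute with `A`. -/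
theorem mul_star_siteV_mul {c : ℕ → ℂ} (hc : Summable fun n => ‖c n‖)
    (hinf : {n | c n ≠ 0}.Infinite) {n : ℕ} (q : Stage n)
    (hp : ∀ x : AlgTensor, Commute (leftMul x) (opA c) →
      AlgTensor.of n q * x * AlgTensor.of n q = x * AlgTensor.of n q) {i : ℕ} (hi : i < n) :
    AlgTensor.of n q * star (siteV i) * AlgTensor.of n q = star (siteV i) * AlgTensor.of n q := by
  obtain ⟨j, hj, hnj⟩ := hinf.exists_gt n
  have hij : i ≠ j := by omega
  have hww := siteV_mul_self j
  have hzz : star (siteV j) * star (siteV j) = 0 := by rw [← star_mul, hww, star_zero]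
  have hvw := siteV_commute i j
  have hvz := siteV_star_commute hij
  have huw : Commute (star (siteV i)) (siteV j) := (siteV_star_commute hij.symm).symm
  have huz : Commute (star (siteV i)) (star (siteV j)) := hvw.star_star
  have hPw : Commute (AlgTensor.of n q) (siteV j) := by
    rw [siteV_eq_site]; exact commute_of_site hnj.le q _
  have hPz : Commute (AlgTensor.of n q) (star (siteV j)) := by
    rw [siteV_eq_site, ← site_star]; exact commute_of_site hnj.le q _
  refine mul_mul_eq_of_twistedFlip (c i) hj hww hzz (siteV_anticomm j) hvw hvz huw huz hPw hPz
    (hp _ (commute_leftMul_opA hc {i, j} ?_ fun k hk => ?_))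
  · rw [Finset.sum_pair hij]
    exact commute_twistedFlip _ _ (siteV_mul_self i) hww (siteV_anticomm i) (siteV_anticomm j)
      hvw hvz huw
  · simp only [Finset.mem_insert, Finset.mem_singleton, not_or] at hk
    have hv := siteV_commute i k
    have hw := siteV_commute j k
    have hu := (siteV_star_commute hk.1).symm
    have hz := (siteV_star_commute hk.2).symm
    exact ((((hu.mul_left hw).smul_left _).add_left ((hv.mul_left hz).smul_left _)).add_left
      ((((hv.mul_left hu).mul_left (hw.mul_left hz)).add_left
        ((hu.mul_left hv).mul_left (hz.mul_left hw))).smul_left _))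

end HyperfiniteTensor

theorem mainTheorem5 (c : ℕ → ℂ) (hc : Summable fun n => ‖c n‖)
    (hinf : {n | c n ≠ 0}.Infinite)
    (p : HyperfiniteTensor.L2 →L[ℂ] HyperfiniteTensor.L2)
    (hp : IsHyperinvariantProjection (HyperfiniteTensor.opA c) p) (hp0 : p ≠ 0) (hp1 : p ≠ 1) :
    p ∉ ⋃ n, HyperfiniteTensor.finiteStage n := by
  open HyperfiniteTensor in
  intro hmem
  obtain ⟨n, q, rfl⟩ := Set.mem_iUnion.mp hmem
  obtain ⟨hproj, hinv⟩ := hp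
  simp only at hproj hinv hp0 hp1
  have hinv' : ∀ x : AlgTensor, Commute (leftMul x) (opA c) →
      AlgTensor.of n q * x * AlgTensor.of n q = x * AlgTensor.of n q := fun x hx =>
    leftMul_injective (by simpa only [map_mul] using hinv _ hx.eq)
  have hself : star (AlgTensor.of n q) = AlgTensor.of n q :=
    leftMul_injective (by rw [map_star]; exact hproj.isSelfAdjoint)
  have hV : ∀ i < n, Commute (siteV i) (AlgTensor.of n q) := fun i hi =>
    commute_of_mul_mul_eq hself
      (hinv' _ (commute_leftMul_opA hc ∅ (by simp) fun k _ => siteV_commute i k))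
      (mul_star_siteV_mul hc hinf q hinv' hi)
  have hU : ∀ i < n, Commute (star (siteV i)) (AlgTensor.of n q) := fun i hi => by
    simpa only [hself] using (hV i hi).star_star
  obtain ⟨r, hr⟩ := mem_range_scalar_of_commute_site (q := q)
    (fun i hi => AlgTensor.of_injective n (by
      simpa only [map_mul, of_stageSite hi, ← siteV_eq_site] using (hV i hi).eq))
    (fun i hi => AlgTensor.of_injective n (by
      simpa only [map_mul, of_stageSite hi, site_star, ← siteV_eq_site] using (hU i hi).eq))
  have hq : leftMul (AlgTensor.of n q) = algebraMap ℂ _ r := by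
    rw [← hr, ← AlgHomClass.commutes leftMul, ← AlgHomClass.commutes (AlgTensor.of n)]
    rfl
  have hidem := hproj.isIdempotentElem.eq
  rw [hq, ← map_mul] at hidem
  have hne : Nontrivial (L2 →L[ℂ] L2) := ⟨_, _, hp0⟩
  have hrr : r * r = r := (algebraMap ℂ (L2 →L[ℂ] L2)).injective hidem
  rcases IsIdempotentElem.iff_eq_zero_or_one.mp hrr with h | h
  · exact hp0 (by rw [hq, h, map_zero])
  · exact hp1 (by rw [hq, h, map_one])
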